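/- A cognitive radio network consists of a finite set $U$ of $n$ users, a finite set $C$ of $k$ channels, for every user $u$ a set $\mathrm{SpecMap}(u)\subseteq C$ and an antenna budget $\beta(u)\in\mathbb{N}$, and a simple graph $\mathcal{PG}=(U,E)$, the potential graph, which may be arbitrary. A spectrum assignment is a function $\mathcal{SA}:U\to 2^{C}$ with $\mathcal{SA}(u)\subseteq \mathrm{SpecMap}(u)$ and $|\mathcal{SA}(u)|\le\beta(u)$ for all $u\in U$; its realization graph has vertex set $U$ and as edges those $\{u,v\}\in E$ with $\mathcal{SA}(u)\cap\mathcal{SA}(v)\ne\emptyset$. The network is connectable if some spectrum assignment has a connected realization graph (a connected graph has at least one vertex). Algorithms are programs of a uniform-cost random access machine whose arithmetic operations are addition and truncated subtraction of natural numbers (no multiplication). The input is given as the numbers $n$ and $k$, the adjacency matrix of $\mathcal{PG}$, the $n\times k$ incidence matrix of the spectrum maps, and the list of the budgets, each budget in one memory cell. Theorem. (a) There is an algorithm that decides whether a given cognitive radio network is connectable in time $2^{O(k+n\log n)}$. (b) There is an algorithm that decides this in time $2^{O(\min\{kn,\;k+n\log n\})}$. Here a time bound $2^{O(f(n,k))}$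 means that there is a constant $c$ such that, for all $n,k\ge 0$ and all networks with $n$ users and $k$ channels, the algorithm halts after at most $2^{c(f(n,k)+1)}$ steps, and $n\log n=0$ for $n=0$. -/

import Mathlib

/-! ### Cognitive radio networks -/

/-- A cognitive radio network with set `U` of secondary users and set `C` of channels:
a spectrum map, a potential graph and an antenna budget for every user. -/
structure CognitiveRadioNetwork (U C : Type*) where
  specMap : U → Finset C
  potentialGraph : SimpleGraph U
  budget : U → ℕ

namespace CognitiveRadioNetwork

variable {U C : Type*}

/-- `SA` is a spectrum assignment: every user opens channels of its spectrum map only, and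
no more of them than its antenna budget. -/
def IsSpectrumAssignment (I : CognitiveRadioNetwork U C) (SA : U → Finset C) : Prop :=
  ∀ u, SA u ⊆ I.specMap u ∧ (SA u).card ≤ I.budget u

/-- The realization graph: the potential edges whose two ends open a common channel. -/
def realizationGraph (I : CognitiveRadioNetwork U C) (SA : U → Finset C) : SimpleGraph U where
  Adj u v := I.potentialGraph.Adj u v ∧ ∃ c, c ∈ SA u ∧ c ∈ SA v
  symm := ⟨fun _ _ h => ⟨h.1.symm, h.2.imp fun _ hc => hc.symm⟩⟩
  loopless := ⟨fun _ h => I.potentialGraph.irrefl h.1⟩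

/-- The network is connectable: some spectrum assignment has a connected realization graph. -/
def Connectable (I : CognitiveRadioNetwork U C) : Prop :=
  ∃ SA : U → Finset C, I.IsSpectrumAssignment SA ∧ (I.realizationGraph SA).Connected

end CognitiveRadioNetwork

/-! ### Random access machines

Programs of a uniform-cost random access machine, in structured form (sequence, branching and
loops in place of jumps). A program works on finitely many registers and finitely many one-way
infinite arrays, all of whose cells hold natural numbers; an array cell can be addressed by a
computed index. The arithmetic operations are addition and truncated subtraction (there is no
multiplication, so in `t` steps numbers grow by at most `t` bits), and every operation that is
executed costs one step. -/

namespace RAM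

/-- A machine state: `s.reg x` is the content of register `x`, and `s.arr a i` is the content
of cell `i` of array `a`. -/
structure State where
  reg : ℕ → ℕ
  arr : ℕ → ℕ → ℕ

/-- The state in which register `x` has been overwritten with `v`. -/
def State.setReg (s : State) (x v : ℕ) : State :=
  { s with reg := Function.update s.reg x v }

/-- The state in which cell `i` of array `a` has been overwritten with `v`. -/
def State.setArr (s : State) (a i v : ℕ) : State :=
  { s with arr := Function.update s.arr a (Function.update (s.arr a) i v) }

/-- Expressions: a constant, the content of register `x`, the content of the cell of array `a`
with a computed index, a sum, and a truncated difference. -/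
inductive Expr where
  | const (m : ℕ)
  | reg (x : ℕ)
  | get (a : ℕ) (i : Expr)
  | add (e f : Expr)
  | sub (e f : Expr)

/-- The value of an expression in a state. -/
def Expr.value (s : State) : Expr → ℕ
  | .const m => m
  | .reg x => s.reg x
  | .get a i => s.arr a (i.value s)
  | .add e f => e.value s + f.value s
  | .sub e f => e.value s - f.value s

/-- The number of steps in which an expression is evaluated: one for each operation in it. -/
def Expr.cost : Expr → ℕ
  | .const _ => 1
  | .reg _ => 1
  | .get _ i => i.cost + 1
  | .add e f => e.cost + f.cost + 1
  | .sub e f => e.cost + f.cost + 1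

/-- Programs. A test `e` of a branching or a loop succeeds if the value of `e` is not zero. -/
inductive Program where
  | skip
  | assign (x : ℕ) (e : Expr)
  | store (a : ℕ) (i e : Expr)
  | seq (p q : Program)
  | ite (e : Expr) (p q : Program)
  | loop (e : Expr) (p : Program)

/-- `Exec p s t s'`: started in state `s`, the program `p` halts after exactly `t` steps, in
state `s'`. -/
inductive Exec : Program → State → ℕ → State → Prop where
  | skip (s : State) : Exec .skip s 1 s
  | assign (s : State) (x : ℕ) (e : Expr) :
      Exec (.assign x e) s (e.cost + 1) (s.setReg x (e.value s))
  | store (s : State) (a : ℕ) (i e : Expr) :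
      Exec (.store a i e) s (i.cost + e.cost + 1) (s.setArr a (i.value s) (e.value s))
  | seq {p q : Program} {s s' s'' : State} {t t' : ℕ} :
      Exec p s t s' → Exec q s' t' s'' → Exec (.seq p q) s (t + t') s''
  | ite_true {e : Expr} {p q : Program} {s s' : State} {t : ℕ} :
      e.value s ≠ 0 → Exec p s t s' → Exec (.ite e p q) s (e.cost + 1 + t) s'
  | ite_false {e : Expr} {p q : Program} {s s' : State} {t : ℕ} :
      e.value s = 0 → Exec q s t s' → Exec (.ite e p q) s (e.cost + 1 + t) s'
  | loop_done {e : Expr} {p : Program} {s : State} :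
      e.value s = 0 → Exec (.loop e p) s (e.cost + 1) s
  | loop_next {e : Expr} {p : Program} {s s' s'' : State} {t t' : ℕ} :
      e.value s ≠ 0 → Exec p s t s' → Exec (.loop e p) s' t' s'' →
        Exec (.loop e p) s (e.cost + 1 + t + t') s''

end RAM

/-! ### Deciding connectability -/

namespace CognitiveRadioNetwork

open Classical in
/-- The machine state that holds a network with `n` users and `k` channels as input: register 0
holds `n` and register 1 holds `k`; array 0 holds the `n × n` adjacency matrix of the potential
graph, row by row; array 1 holds the `n × k` incidence matrix of the spectrum maps, row by row;
array 2 holds the antenna budgets. Everything else is zero. -/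
noncomputable def inputState {n k : ℕ} (I : CognitiveRadioNetwork (Fin n) (Fin k)) :
    RAM.State where
  reg x := if x = 0 then n else if x = 1 then k else 0
  arr a i :=
    if a = 0 then
      if ∃ u v : Fin n, i = u * n + v ∧ I.potentialGraph.Adj u v then 1 else 0
    else if a = 1 then
      if ∃ (u : Fin n) (c : Fin k), i = u * k + c ∧ c ∈ I.specMap u then 1 else 0
    else if a = 2 then
      if h : i < n then I.budget ⟨i, h⟩ else 0
    else 0

end CognitiveRadioNetwork

/-- The program `p` solves the spectrum connectivity problem in time `T`: on every network with
`n` users and `k` channels it halts after at most `T n k` steps, and then register 0 holds 1 if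
the network is connectable, and 0 if it is not. -/
def DecidesSpectrumConnectivity (p : RAM.Program) (T : ℕ → ℕ → ℝ) : Prop :=
  ∀ (n k : ℕ) (I : CognitiveRadioNetwork (Fin n) (Fin k)),
    ∃ (t : ℕ) (s : RAM.State), RAM.Exec p I.inputState t s ∧ (t : ℝ) ≤ T n k ∧
      (I.Connectable → s.reg 0 = 1) ∧ (¬ I.Connectable → s.reg 0 = 0)

/-- The spectrum connectivity problem can be solved in time `2 ^ O(f n k)`, by one program for
all `n` and `k`. The summand 1 lets the time be a constant, and not only one step, where
`f n k = 0`; where `f n k ≥ 1`, it can be absorbed in the constant `c`. -/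
def SpectrumConnectivitySolvableInTwoPowO (f : ℕ → ℕ → ℝ) : Prop :=
  ∃ (p : RAM.Program) (c : ℝ),
    DecidesSpectrumConnectivity p (fun n k => (2 : ℝ) ^ (c * (f n k + 1)))

/-! One dynamic program proves both bounds; its running time is a polynomial in `2 ^ n` and `k`.
Root a connected realization graph at a user and build a spanning tree from the leaves up. For a
partial tree it is enough to remember its root `v`, one open channel `c` of `v`, the number `b` of
further channels counted at `v`, and the users gathered so far: the children of `v` can be grouped
by channel and attached one channel after the other, so earlier channels may be forgotten. These are
the facts `Gathers`.

The gathered users are remembered only through the sum `X` of their weights `2 ^ n + 2 ^ u`. Joining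
two trees is then a single addition, without a test of disjointness. Trees that overlap do produce
false intermediate sums, but a multiset of users whose weight is the total weight contains every
user exactly once (`eq_one_of_sum_userWeight`), so the final answer is right. Soundness is
`Gathers.exists_assignment`, completeness `Connectable.exists_gathers`.

There are `(n + 1) * 2 ^ n * k ^ 2 * n` facts. Numbered with the weight as leading digit and then
`b`, every derived fact has premises with smaller numbers (`Holds.cases`), so one pass in increasing
order, trying all pairs of premises, finds all of them in cubic time. This is `2 ^ O(n + k)`, and
for `n, k ≥ 1` the sum `n + k` is at most `min (k * n) (k + n * log n) + 1`. -/

/-! ### Connected graphs grow from every vertex -/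

/-- `W` arises from single vertices by joining disjoint rooted sets along an edge between their
roots; `v` is the root of `W`. -/
inductive SimpleGraph.GrowsFrom {V : Type*} [DecidableEq V] (G : SimpleGraph V) :
    V → Finset V → Prop where
  | single (v : V) : GrowsFrom G v {v}
  | join {v u : V} {W W' : Finset V} : GrowsFrom G v W → GrowsFrom G u W' → Disjoint W W' →
      G.Adj v u → GrowsFrom G v (W ∪ W')

namespace SimpleGraph.GrowsFrom

variable {V : Type*} [DecidableEq V] {G : SimpleGraph V}

theorem root_mem {v : V} {W : Finset V} (h : G.GrowsFrom v W) : v ∈ W := by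
  induction h with
  | single v => simp
  | join _ _ _ _ ih _ => exact Finset.mem_union_left _ ih

/-- The new vertex becomes a leaf below `a`: the induction descends into the part that contains `a`
until that part is the single vertex `a`. -/
theorem insert {v : V} {W : Finset V} (h : G.GrowsFrom v W) {a b : V} (ha : a ∈ W) (hb : b ∉ W)
    (hab : G.Adj a b) : G.GrowsFrom v (insert b W) := by
  induction h with
  | single v =>
    obtain rfl := Finset.mem_singleton.1 ha
    have := (single (G := G) a).join (single b) (by simpa [eq_comm] using hb) hab
    rwa [Finset.union_comm] at this
  | @join v u W W' h h' hd hvu ih ih' =>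
    rw [Finset.mem_union, not_or] at hb
    rcases Finset.mem_union.1 ha with ha | ha
    · rw [← Finset.insert_union]
      exact (ih ha hb.1).join h' (by simp [hd, hb.2]) hvu
    · rw [← Finset.union_insert]
      exact h.join (ih' ha hb.2) (by simp [hd, hb.1]) hvu

end SimpleGraph.GrowsFrom

/-- A maximal set grown from `v` is everything, since otherwise an edge leaves it and its outer end
can be inserted. -/
theorem SimpleGraph.Connected.growsFrom_univ {V : Type*} [Fintype V] [DecidableEq V]
    {G : SimpleGraph V} (hG : G.Connected) (v : V) : G.GrowsFrom v Finset.univ := by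
  obtain ⟨W, hW⟩ := (Set.toFinite {W : Finset V | G.GrowsFrom v W}).exists_maximal
    ⟨{v}, .single v⟩
  have hWv : G.GrowsFrom v W := hW.prop
  by_cases h : W = Finset.univ
  · exact h ▸ hWv
  obtain ⟨x, hx⟩ : ∃ x, x ∉ W := by simpa [Finset.eq_univ_iff_forall] using h
  obtain ⟨p⟩ := hG.preconnected v x
  obtain ⟨d, -, hd, hd'⟩ := p.exists_boundary_dart (W : Set V) (by exact_mod_cast hWv.root_mem)
    (by exact_mod_cast hx)
  have hle := hW.le_of_ge (y := Insert.insert d.snd W)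
    (hWv.insert (by exact_mod_cast hd) (by exact_mod_cast hd') d.adj) (Finset.subset_insert _ _)
  exact absurd (hle (Finset.mem_insert_self _ _)) (by exact_mod_cast hd')

/-! ### Sums of few powers of two -/

/-- The last `n` binary digits of `j * 2 ^ n - 1` are all 1, and each needs a summand of its own.
Here `g` is the carry from lower digits: `f 0 + g` is odd, so it leaves a unit in place and carries
`(f 0 + g) / 2`. -/
theorem le_sum_of_sum_two_pow (n : ℕ) : ∀ (f : ℕ → ℕ) (g j : ℕ),
    ∑ i ∈ Finset.range n, f i * 2 ^ i + g + 1 = j * 2 ^ n →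
    n ≤ ∑ i ∈ Finset.range n, f i + g := by
  induction n with
  | zero => simp
  | succ n ih =>
    intro f g j h
    rw [Finset.sum_range_succ'] at h ⊢
    have e : ∑ i ∈ Finset.range n, f (i + 1) * 2 ^ (i + 1) =
        2 * ∑ i ∈ Finset.range n, f (i + 1) * 2 ^ i := by
      rw [Finset.mul_sum]; exact Finset.sum_congr rfl fun i _ => by ring
    rw [e, pow_succ, ← mul_assoc] at h
    have := ih (fun i => f (i + 1)) ((f 0 + g) / 2) j (by omega)
    omega

/-- The case of equality in `le_sum_of_sum_two_pow`: with only `n` summands nothing can be spent on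
carries, so `f 0 + g = 1` at every digit. -/
theorem le_one_of_sum_two_pow (n : ℕ) : ∀ (f : ℕ → ℕ) (g j : ℕ),
    ∑ i ∈ Finset.range n, f i * 2 ^ i + g + 1 = j * 2 ^ n →
    ∑ i ∈ Finset.range n, f i + g ≤ n → ∀ i < n, f i ≤ 1 := by
  induction n with
  | zero => simp
  | succ n ih =>
    intro f g j h hle i hi
    rw [Finset.sum_range_succ'] at h hle
    have e : ∑ i ∈ Finset.range n, f (i + 1) * 2 ^ (i + 1) =
        2 * ∑ i ∈ Finset.range n, f (i + 1) * 2 ^ i := by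
      rw [Finset.mul_sum]; exact Finset.sum_congr rfl fun i _ => by ring
    rw [e, pow_succ, ← mul_assoc] at h
    have hn : ∑ i ∈ Finset.range n, f (i + 1) * 2 ^ i + (f 0 + g) / 2 + 1 = j * 2 ^ n := by omega
    have h1 := le_sum_of_sum_two_pow n (fun i => f (i + 1)) _ j hn
    cases i with
    | zero => omega
    | succ i => exact ih (fun i => f (i + 1)) _ j hn (by omega) i (by omega)

/-- The weight of user `u` among `n` users. A multiset of users that has the same total weight
as the set of all users is that set. -/
def userWeight (n u : ℕ) : ℕ := 2 ^ n + 2 ^ u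

/-- The total weight of all `n` users. -/
def totalWeight (n : ℕ) : ℕ := ∑ u ∈ Finset.range n, userWeight n u

theorem totalWeight_add_one (n : ℕ) : totalWeight n + 1 = (n + 1) * 2 ^ n := by
  have : ∑ u ∈ Finset.range n, 2 ^ u + 1 = 2 ^ n := by
    have := Nat.geomSum_eq (le_refl 2) n
    have := Nat.one_le_two_pow (n := n)
    simp only [Nat.add_one_sub_one, Nat.div_one] at *
    omega
  simp only [totalWeight, userWeight, Finset.sum_add_distrib, Finset.sum_const, Finset.card_range,
    smul_eq_mul]
  linarith

theorem le_one_of_sum_userWeight {n : ℕ} (f : ℕ → ℕ)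
    (h : ∑ u ∈ Finset.range n, f u * userWeight n u = totalWeight n) :
    ∀ u < n, f u ≤ 1 := by
  have ht := totalWeight_add_one n
  simp only [userWeight, mul_add, Finset.sum_add_distrib, ← Finset.sum_mul] at h
  have hle : ∑ u ∈ Finset.range n, f u ≤ n := by
    have : (∑ u ∈ Finset.range n, f u) * 2 ^ n < (n + 1) * 2 ^ n := by omega
    exact Nat.lt_succ_iff.1 (lt_of_mul_lt_mul_right this (Nat.zero_le _))
  -- The parts `2 ^ n` of the weights bound the number of summands by `n`; moved to the other side,
  -- they leave this multiple of `2 ^ n`.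
  refine le_one_of_sum_two_pow n f 0 (n + 1 - ∑ u ∈ Finset.range n, f u) ?_ hle
  rw [Nat.sub_mul]
  omega

theorem eq_one_of_sum_userWeight {n : ℕ} (f : Fin n → ℕ)
    (h : ∑ u, f u * userWeight n u = totalWeight n) : ∀ u, f u = 1 := by
  have hle : ∀ u, f u ≤ 1 := by
    intro u
    have := le_one_of_sum_userWeight (n := n) (fun i => if h : i < n then f ⟨i, h⟩ else 0)
      (by rw [← h, Finset.sum_range]; simp) u u.2
    simpa using this
  rw [totalWeight, Finset.sum_range] at h
  have h2 := (Finset.sum_eq_sum_iff_of_le (s := Finset.univ) (f := fun u => f u * userWeight n u)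
    (g := fun u : Fin n => userWeight n u)
    (fun u _ => by simpa using Nat.mul_le_mul_right (userWeight n u) (hle u))).1 h
  intro u
  have h3 := h2 u (Finset.mem_univ _)
  have h4 : 0 < userWeight n u := by unfold userWeight; positivity
  exact Nat.eq_of_mul_eq_mul_right h4 (by simpa using h3)

/-! ### Gathering users along channels -/

namespace CognitiveRadioNetwork

variable {U C : Type*}

/-- `I.Gathers w m v c b X`: user `v` can gather users of total weight `X` (with multiplicity, and
including itself) as its descendants in a tree, where `v` has channel `c` open and opens at most
`b < m` further channels, and the users at both ends of every edge of the tree open a common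
channel. -/
inductive Gathers (I : CognitiveRadioNetwork U C) (w : U → ℕ) (m : ℕ) :
    U → C → ℕ → ℕ → Prop where
  | single {v : U} {c : C} : c ∈ I.specMap v → 1 ≤ I.budget v → Gathers I w m v c 0 (w v)
  | switch {v : U} {c c' : C} {b X : ℕ} : Gathers I w m v c b X → c' ∈ I.specMap v →
      b + 2 ≤ I.budget v → b + 1 < m → Gathers I w m v c' (b + 1) X
  | join {v u : U} {c : C} {b b' X X' : ℕ} : Gathers I w m v c b X → Gathers I w m u c b' X' →
      I.potentialGraph.Adj v u → Gathers I w m v c b (X + X')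

variable {I : CognitiveRadioNetwork U C} {w : U → ℕ} {m : ℕ}

theorem Gathers.pos (hw : ∀ u, 0 < w u) {v : U} {c : C} {b X : ℕ} (h : I.Gathers w m v c b X) :
    0 < X := by
  induction h with
  | single _ _ => exact hw _
  | switch _ _ _ _ ih => exact ih
  | join _ _ _ ih _ => omega

theorem Gathers.lt (hm : 0 < m) {v : U} {c : C} {b X : ℕ} (h : I.Gathers w m v c b X) :
    b < m := by
  induction h with
  | single _ _ => exact hm
  | switch _ _ _ h _ => exact h
  | join _ _ _ ih _ => exact ih

theorem realizationGraph_mono {SA SA' : U → Finset C} (h : ∀ u, SA u ⊆ SA' u) :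
    I.realizationGraph SA ≤ I.realizationGraph SA' :=
  fun u v huv => ⟨huv.1, huv.2.imp fun _ hc => ⟨h u hc.1, h v hc.2⟩⟩

/-- `f` counts how often each user is gathered. Only a derivation without repetition yields an
assignment, because two subtrees that share a user may open different channels there. Reopening a
channel in a switch only lowers the cardinality. -/
theorem Gathers.exists_assignment [Fintype U] {v : U} {c : C} {b X : ℕ}
    (h : I.Gathers w m v c b X) :
    ∃ f : U → ℕ, ∑ u, f u * w u = X ∧ f v ≠ 0 ∧ ((∀ u, f u ≤ 1) →
      ∃ SA, I.IsSpectrumAssignment SA ∧ (∀ u, f u = 0 → SA u = ∅) ∧ c ∈ SA v ∧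
        (SA v).card ≤ b + 1 ∧ ∀ u, f u ≠ 0 → (I.realizationGraph SA).Reachable v u) := by
  classical
  induction h with
  | @single v c hc hb =>
    refine ⟨fun u => if u = v then 1 else 0, by simp, by simp, fun _ =>
      ⟨fun u => if u = v then {c} else ∅, fun u => ?_, ?_, by simp, by simp, ?_⟩⟩
    · by_cases hu : u = v
      · subst hu; simpa using ⟨hc, hb⟩
      · simp [hu]
    · intro u hu; simpa using hu
    · intro u hu
      obtain rfl : u = v := by simpa using hu
      exact .refl _
  | @switch v c c' b X _ hc' hb _ ih =>
    obtain ⟨f, hX, hv, h⟩ := ih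
    refine ⟨f, hX, hv, fun hf => ?_⟩
    obtain ⟨SA, hSA, h0, hc, hcard, hr⟩ := h hf
    have hcard' : (insert c' (SA v)).card ≤ b + 1 + 1 :=
      (Finset.card_insert_le _ _).trans (by omega)
    have hsub : ∀ u, SA u ⊆ Function.update SA v (insert c' (SA v)) u := by
      intro u
      by_cases hu : u = v
      · subst hu; simp
      · simp [hu]
    refine ⟨Function.update SA v (insert c' (SA v)), fun u => ?_, ?_, by simp, by simpa using hcard',
      fun u hu => (hr u hu).mono (realizationGraph_mono hsub)⟩
    · by_cases hu : u = v
      · subst hu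
        simp only [Function.update_self]
        exact ⟨Finset.insert_subset hc' (hSA u).1, by omega⟩
      · simpa [hu] using hSA u
    · intro u hu
      have : u ≠ v := by rintro rfl; exact hv hu
      simpa [this] using h0 u hu
  | @join v u c b b' X X' _ _ hadj ih ih' =>
    obtain ⟨f, hX, hv, h⟩ := ih
    obtain ⟨f', hX', hu, h'⟩ := ih'
    refine ⟨fun x => f x + f' x, by simp [add_mul, Finset.sum_add_distrib, hX, hX'],
      (Nat.add_pos_left (Nat.pos_of_ne_zero hv) _).ne',
      fun hf => ?_⟩
    have hf (x : U) : f x + f' x ≤ 1 := hf x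
    obtain ⟨SA, hSA, h0, hc, hcard, hr⟩ := h fun x => by have := hf x; omega
    obtain ⟨SA', hSA', h0', hc', -, hr'⟩ := h' fun x => by have := hf x; omega
    -- No user is gathered on both sides, and each assignment is empty off its own users, so the
    -- union never mixes two nonempty channel sets.
    have hcase : ∀ x, (SA x ∪ SA' x = SA x ∧ f x ≠ 0) ∨ SA x ∪ SA' x = SA' x := by
      intro x
      by_cases hx : f x = 0
      · right; simp [h0 x hx]
      · left; simp [hx, h0' x (by have := hf x; omega)]
    have hv' : SA v ∪ SA' v = SA v := by simp [h0' v (by have := hf v; omega)]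
    have hle : I.realizationGraph SA ≤ I.realizationGraph fun x => SA x ∪ SA' x :=
      realizationGraph_mono fun x => Finset.subset_union_left
    have hle' : I.realizationGraph SA' ≤ I.realizationGraph fun x => SA x ∪ SA' x :=
      realizationGraph_mono fun x => Finset.subset_union_right
    refine ⟨fun x => SA x ∪ SA' x, fun x => ?_, fun x hx => ?_, Finset.mem_union_left _ hc, ?_,
      fun x hx => ?_⟩
    · rcases hcase x with h | h
      · simpa only [h.1] using hSA x
      · simpa only [h] using hSA' x
    · have hx : f x + f' x = 0 := hx
      simp [h0 x (by omega), h0' x (by omega)]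
    · simpa only [hv'] using hcard
    · have hx : f x + f' x ≠ 0 := hx
      by_cases hfx : f x = 0
      · have hvu : (I.realizationGraph fun x => SA x ∪ SA' x).Adj v u :=
          ⟨hadj, c, Finset.mem_union_left _ hc, Finset.mem_union_right _ hc'⟩
        exact hvu.reachable.trans ((hr' x (by omega)).mono hle')
      · exact (hr x hfx).mono hle

theorem Gathers.connectable {n : ℕ} {I : CognitiveRadioNetwork (Fin n) C} {v : Fin n} {c : C}
    {b : ℕ} (h : I.Gathers (fun u => userWeight n u) m v c b (totalWeight n)) :
    I.Connectable := by
  obtain ⟨f, hX, -, h⟩ := h.exists_assignment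
  have hf := eq_one_of_sum_userWeight f hX
  obtain ⟨SA, hSA, -, -, -, hr⟩ := h fun u => (hf u).le
  exact ⟨SA, hSA, (SimpleGraph.connected_iff_exists_forall_reachable _).2
    ⟨v, fun u => hr u (by simp [hf u])⟩⟩

/-- The weights that can be attached to user `v` along channel `c`. -/
def attachable (I : CognitiveRadioNetwork U C) (w : U → ℕ) (m : ℕ) (v : U) (c : C) :
    AddSubmonoid ℕ :=
  AddSubmonoid.closure {X | ∃ u b, I.potentialGraph.Adj v u ∧ I.Gathers w m u c b X}

theorem Gathers.attach {v : U} {c : C} {b X Y : ℕ} (h : I.Gathers w m v c b X)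
    (hY : Y ∈ I.attachable w m v c) : I.Gathers w m v c b (X + Y) := by
  induction hY using AddSubmonoid.closure_induction generalizing X with
  | mem Y hY =>
    obtain ⟨u, b', hadj, hu⟩ := hY
    exact h.join hu hadj
  | zero => exact h
  | add Y Y' _ _ ih ih' => rw [← add_assoc]; exact ih' (ih h)

/-- Open the channels of `A` one after the other, attaching to each its whole share, and switch to
`c` last. -/
theorem gathers_of_attachable {v : U} {Y : C → ℕ} (hY : ∀ c, Y c ∈ I.attachable w m v c)
    (A : Finset C) : ∀ c ∉ A, c ∈ I.specMap v → A ⊆ I.specMap v → A.card + 1 ≤ I.budget v →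
      A.card + 1 ≤ m → I.Gathers w m v c A.card (w v + ∑ a ∈ A, Y a + Y c) := by
  classical
  induction A using Finset.induction_on with
  | empty =>
    intro c _ hc _ hb _
    simpa using (Gathers.single hc (by simpa using hb)).attach (hY c)
  | insert a A ha ih =>
    intro c _ hc hA hb hm
    rw [Finset.card_insert_of_notMem ha] at hb hm ⊢
    rw [Finset.insert_subset_iff] at hA
    have := (ih a ha hA.1 hA.2 (by omega) (by omega)).switch hc (by omega) (by omega)
    rw [Finset.sum_insert ha, add_comm (Y a), ← add_assoc]
    exact this.attach (hY c)

/-- Any open channel can be made the last one. The choice must be free because the edge to the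
parent dictates the channel. -/
theorem IsSpectrumAssignment.gathers_of_attachable {SA : U → Finset C}
    (hSA : I.IsSpectrumAssignment SA) (hm : ∀ v, (SA v).card ≤ m) {v : U} {Y : C → ℕ}
    (hY : ∀ c, Y c ∈ I.attachable w m v c) {c : C} (hc : c ∈ SA v) :
    ∃ b, I.Gathers w m v c b (w v + ∑ a ∈ SA v, Y a) := by
  classical
  have hcard := Finset.card_erase_add_one hc
  have := CognitiveRadioNetwork.gathers_of_attachable hY ((SA v).erase c) c
    (Finset.notMem_erase _ _) ((hSA v).1 hc) ((Finset.erase_subset _ _).trans (hSA v).1)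
    (hcard.trans_le (hSA v).2) (hcard.trans_le (hm v))
  rw [add_assoc, Finset.sum_erase_add _ _ hc] at this
  exact ⟨_, this⟩

theorem IsSpectrumAssignment.exists_attachable [DecidableEq U] {SA : U → Finset C}
    (hSA : I.IsSpectrumAssignment SA) (hm : ∀ v, (SA v).card ≤ m) {v : U} {W : Finset U}
    (hW : (I.realizationGraph SA).GrowsFrom v W) :
    ∃ Y : C → ℕ, (∀ c, Y c ∈ I.attachable w m v c) ∧
      ∑ u ∈ W, w u = w v + ∑ a ∈ SA v, Y a := by
  classical
  induction hW with
  | single v => exact ⟨0, fun c => zero_mem _, by simp⟩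
  | @join v u W W' _ _ hd hadj ih ih' =>
    obtain ⟨Y, hY, hs⟩ := ih
    obtain ⟨Y', hY', hs'⟩ := ih'
    obtain ⟨hadj, c, hc, hc'⟩ := hadj
    obtain ⟨b, hb⟩ := hSA.gathers_of_attachable hm hY' hc'
    -- The whole subtree of `u` is booked on the channel `c` that `u` shares with `v`.
    refine ⟨Y + Pi.single c (∑ x ∈ W', w x), fun a => add_mem (hY a) ?_, ?_⟩
    · by_cases ha : a = c
      · subst ha
        rw [Pi.single_eq_same, hs']
        exact AddSubmonoid.subset_closure ⟨u, b, hadj, hb⟩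
      · rw [Pi.single_eq_of_ne ha]; exact zero_mem _
    · rw [Finset.sum_union hd, hs]
      simp only [Pi.add_apply, Finset.sum_add_distrib, Finset.sum_pi_single', hc, if_true]
      ring

theorem Connectable.exists_gathers {n k : ℕ} {I : CognitiveRadioNetwork (Fin n) (Fin k)}
    (h : I.Connectable) (hn : 2 ≤ n) :
    ∃ v c b, I.Gathers (fun u : Fin n => userWeight n u) k v c b (totalWeight n) := by
  obtain ⟨SA, hSA, hG⟩ := h
  have hm : ∀ v, (SA v).card ≤ k := fun v => (Finset.card_le_univ _).trans (by simp)
  have : Nontrivial (Fin n) := Fin.nontrivial_iff_two_le.2 hn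
  let v : Fin n := ⟨0, by omega⟩
  -- An edge at the root provides an open channel there; a lone user need not have one, whence `2 ≤
  -- n`.
  obtain ⟨u, hvu⟩ := hG.preconnected.exists_adj_of_nontrivial v
  obtain ⟨-, c, hc, -⟩ := hvu
  obtain ⟨Y, hY, hs⟩ := hSA.exists_attachable (w := fun u : Fin n => userWeight n u) hm
    (hG.growsFrom_univ v)
  obtain ⟨b, hb⟩ := hSA.gathers_of_attachable hm hY hc
  refine ⟨v, c, b, ?_⟩
  rwa [← hs, ← Finset.sum_range (userWeight n)] at hb

end CognitiveRadioNetwork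

/-! ### Running time and correctness of programs -/

namespace RAM

/-- Started in state `s`, the program `p` halts after at most `T` steps, in a state that
satisfies `Q`. -/
def Runs (p : Program) (s : State) (T : ℕ) (Q : State → Prop) : Prop :=
  ∃ t s', Exec p s t s' ∧ t ≤ T ∧ Q s'

theorem Runs.mono {p : Program} {s : State} {T T' : ℕ} {Q Q' : State → Prop}
    (h : Runs p s T Q) (hT : T ≤ T') (hQ : ∀ s', Q s' → Q' s') : Runs p s T' Q' :=
  let ⟨t, s', he, ht, hs⟩ := h
  ⟨t, s', he, ht.trans hT, hQ s' hs⟩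

theorem Runs.seq {p q : Program} {s : State} {T T' : ℕ} {R Q : State → Prop}
    (hp : Runs p s T R) (hq : ∀ s', R s' → Runs q s' T' Q) : Runs (.seq p q) s (T + T') Q := by
  obtain ⟨t, s', he, ht, hs⟩ := hp
  obtain ⟨t', s'', he', ht', hs'⟩ := hq s' hs
  exact ⟨_, s'', he.seq he', Nat.add_le_add ht ht', hs'⟩

theorem Runs.assign {s : State} {x : ℕ} {e : Expr} {Q : State → Prop}
    (h : Q (s.setReg x (e.value s))) : Runs (.assign x e) s (e.cost + 1) Q :=
  ⟨_, _, .assign s x e, le_rfl, h⟩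

theorem Runs.store {s : State} {a : ℕ} {i e : Expr} {Q : State → Prop}
    (h : Q (s.setArr a (i.value s) (e.value s))) :
    Runs (.store a i e) s (i.cost + e.cost + 1) Q :=
  ⟨_, _, .store s a i e, le_rfl, h⟩

theorem Runs.assign_seq {s : State} {x T : ℕ} {e : Expr} {q : Program} {Q : State → Prop}
    (h : Runs q (s.setReg x (e.value s)) T Q) :
    Runs (.seq (.assign x e) q) s (e.cost + 1 + T) Q :=
  (Runs.assign (Q := (· = s.setReg x (e.value s))) rfl).seq fun _ hs => hs ▸ h

theorem Runs.store_seq {s : State} {a T : ℕ} {i e : Expr} {q : Program} {Q : State → Prop}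
    (h : Runs q (s.setArr a (i.value s) (e.value s)) T Q) :
    Runs (.seq (.store a i e) q) s (i.cost + e.cost + 1 + T) Q :=
  (Runs.store (Q := (· = s.setArr a (i.value s) (e.value s))) rfl).seq fun _ hs => hs ▸ h

theorem Runs.ite {s : State} {e : Expr} {p q : Program} {T : ℕ} {Q : State → Prop}
    (hp : e.value s ≠ 0 → Runs p s T Q) (hq : e.value s = 0 → Runs q s T Q) :
    Runs (.ite e p q) s (e.cost + 1 + T) Q := by
  by_cases h : e.value s = 0
  · obtain ⟨t, s', he, ht, hs⟩ := hq h
    exact ⟨_, s', .ite_false h he, Nat.add_le_add_left ht _, hs⟩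
  · obtain ⟨t, s', he, ht, hs⟩ := hp h
    exact ⟨_, s', .ite_true h he, Nat.add_le_add_left ht _, hs⟩

theorem Runs.skip {s : State} {Q : State → Prop} (h : Q s) : Runs .skip s 1 Q :=
  ⟨_, _, .skip s, le_rfl, h⟩

/-- Run `p` for every value of register `i` that is less than the content of register `m`. -/
def Program.forLoop (i m : ℕ) (p : Program) : Program :=
  .seq (.assign i (.const 0))
    (.loop (.sub (.reg m) (.reg i)) (.seq p (.assign i (.add (.reg i) (.const 1)))))

/-- By `hset` the invariant ignores the counter. Each round costs 4 steps for the test and 4 for the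
increment; the initialization and the last test cost 6. -/
theorem Runs.forLoop {P : ℕ → State → Prop} {i m N T : ℕ} {p : Program} {s : State}
    (hN : ∀ j s, P j s → s.reg m = N)
    (hset : ∀ j s v, P j s → P j (s.setReg i v))
    (hbody : ∀ j < N, ∀ s, P j s → s.reg i = j →
      Runs p s T fun s' => P (j + 1) s' ∧ s'.reg i = j)
    (h : P 0 s) : Runs (.forLoop i m p) s (N * (T + 8) + 6) (P N) := by
  have key : ∀ d j, j + d = N → ∀ s, P j s → s.reg i = j →
      Runs (.loop (.sub (.reg m) (.reg i)) (.seq p (.assign i (.add (.reg i) (.const 1))))) s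
        (d * (T + 8) + 4) (P N) := by
    intro d
    induction d with
    | zero =>
      rintro j rfl s hP hi
      refine ⟨_, s, .loop_done ?_, ?_, hP⟩
      · simp only [Expr.value, hN j s hP, hi]; omega
      · simp [Expr.cost]
    | succ d ih =>
      intro j hj s hP hi
      obtain ⟨t, s', he, ht, hP', hi'⟩ := hbody j (by omega) s hP hi
      have hv : (Expr.add (.reg i) (.const 1)).value s' = j + 1 := by simp [Expr.value, hi']
      obtain ⟨t', s'', he', ht', hQ⟩ := ih (j + 1) (by omega) (s'.setReg i (j + 1))
        (hset _ _ _ hP') (by simp [State.setReg])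
      refine ⟨_, s'', .loop_next ?_ (he.seq (.assign s' i _)) (by rw [hv]; exact he'), ?_, hQ⟩
      · simp only [Expr.value, hN j s hP, hi]; omega
      · simp only [Expr.cost, Nat.add_mul]; omega
  refine (Runs.seq (T := 2) (R := fun s => P 0 s ∧ s.reg i = 0) (.assign ?_)
    fun s' hs => key N 0 (by omega) s' hs.1 hs.2).mono (by omega) fun _ h => h
  exact ⟨hset _ _ _ h, by simp [State.setReg, Expr.value]⟩

end RAM

/-! ### Numbering the facts of the gathering relation -/

namespace CognitiveRadioNetwork

theorem lt_of_weight_lt {n k q₁ q : ℕ} (h : q₁ / n / k / k < q / n / k / k) : q₁ < q := by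
  by_contra! hle
  exact h.not_ge (Nat.div_le_div_right (Nat.div_le_div_right (Nat.div_le_div_right hle)))

theorem lt_of_switches_lt {n k q₁ q : ℕ} (hX : q₁ / n / k / k = q / n / k / k)
    (h : q₁ / n / k % k < q / n / k % k) : q₁ < q := by
  by_contra! hle
  have h1 : q / n / k ≤ q₁ / n / k := Nat.div_le_div_right (Nat.div_le_div_right hle)
  have h2 := Nat.div_add_mod (q / n / k) k
  have h3 := Nat.div_add_mod (q₁ / n / k) k
  rw [hX] at h3
  omega

section Facts

variable {n k : ℕ} [NeZero n] [NeZero k] (I : CognitiveRadioNetwork (Fin n) (Fin k))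

/-- The fact with number `q`, where `q = ((X * k + b) * k + c) * n + v`. -/
def Holds (q : ℕ) : Prop :=
  I.Gathers (fun u => userWeight n u) k (Fin.ofNat n q) (Fin.ofNat k (q / n)) (q / n / k % k)
    (q / n / k / k)

/-- Fact `q` holds by the rule `Gathers.single`. -/
def IsSingle (q : ℕ) : Prop :=
  Fin.ofNat k (q / n) ∈ I.specMap (Fin.ofNat n q) ∧ 1 ≤ I.budget (Fin.ofNat n q) ∧
    q / n / k % k = 0 ∧ q / n / k / k = userWeight n (q % n)

/-- Fact `q` follows from fact `q₁` by the rule `Gathers.switch`. -/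
def IsSwitch (q₁ q : ℕ) : Prop :=
  q₁ % n = q % n ∧ q₁ / n / k / k = q / n / k / k ∧ q / n / k % k = q₁ / n / k % k + 1 ∧
    Fin.ofNat k (q / n) ∈ I.specMap (Fin.ofNat n q) ∧
    q / n / k % k + 1 ≤ I.budget (Fin.ofNat n q)

/-- Fact `q` follows from the facts `q₁` and `q₂` by the rule `Gathers.join`. -/
def IsJoin (q₁ q₂ q : ℕ) : Prop :=
  q₁ % n = q % n ∧ q₁ / n % k = q / n % k ∧ q₂ / n % k = q / n % k ∧
    q₁ / n / k % k = q / n / k % k ∧ q / n / k / k = q₁ / n / k / k + q₂ / n / k / k ∧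
    I.potentialGraph.Adj (Fin.ofNat n q) (Fin.ofNat n q₂)

variable {I}

theorem IsSingle.holds {q : ℕ} (h : I.IsSingle q) : I.Holds q := by
  obtain ⟨h1, h2, h3, h4⟩ := h
  have := Gathers.single (w := fun u : Fin n => userWeight n u) (m := k) h1 h2
  rw [Holds, h3, h4]
  exact this

/-- The side condition `b + 1 < m` of the rule needs no test, since `b + 1` is a digit in base `k`.
-/
theorem IsSwitch.holds {q₁ q : ℕ} (h : I.IsSwitch q₁ q) (h₁ : I.Holds q₁) : I.Holds q := by
  obtain ⟨hv, hX, hb, hc, hβ⟩ := h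
  have ev : Fin.ofNat n q₁ = Fin.ofNat n q := Fin.ext hv
  rw [Holds, ev, hX] at h₁
  rw [Holds, hb]
  exact h₁.switch hc (by omega) (hb ▸ Nat.mod_lt _ (NeZero.pos k))

theorem IsJoin.holds {q₁ q₂ q : ℕ} (h : I.IsJoin q₁ q₂ q) (h₁ : I.Holds q₁) (h₂ : I.Holds q₂) :
    I.Holds q := by
  obtain ⟨hv, hc₁, hc₂, hb, hX, hadj⟩ := h
  have ev : Fin.ofNat n q₁ = Fin.ofNat n q := Fin.ext hv
  have ec : Fin.ofNat k (q₁ / n) = Fin.ofNat k (q / n) := Fin.ext hc₁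
  have ec' : Fin.ofNat k (q₂ / n) = Fin.ofNat k (q / n) := Fin.ext hc₂
  rw [Holds, ev, ec, hb] at h₁
  rw [Holds, ec'] at h₂
  rw [Holds, hX]
  exact h₁.join h₂ hadj

theorem exists_number (v : Fin n) (c : Fin k) {b : ℕ} (X : ℕ) (hb : b < k) :
    ∃ q, Fin.ofNat n q = v ∧ Fin.ofNat k (q / n) = c ∧ q / n / k % k = b ∧ q / n / k / k = X := by
  have h1 : (((X * k + b) * k + c) * n + v) / n = (X * k + b) * k + c := by
    rw [mul_comm _ n, Nat.mul_add_div (NeZero.pos n), Nat.div_eq_of_lt v.2, add_zero]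
  have h2 : ((X * k + b) * k + c) / k = X * k + b := by
    rw [mul_comm _ k, Nat.mul_add_div (NeZero.pos k), Nat.div_eq_of_lt c.2, add_zero]
  have h3 : (X * k + b) / k = X := by
    rw [mul_comm _ k, Nat.mul_add_div (NeZero.pos k), Nat.div_eq_of_lt hb, add_zero]
  refine ⟨((X * k + b) * k + c) * n + v, Fin.ext ?_, Fin.ext ?_, ?_, ?_⟩
  · simp [Nat.mod_eq_of_lt v.2]
  · rw [h1]; simp [Nat.mod_eq_of_lt c.2]
  · rw [h1, h2]; simp [Nat.mod_eq_of_lt hb]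
  · rw [h1, h2, h3]

/-- Premises have smaller numbers: a join adds positive weights, so both premises have smaller
leading digits, and a switch keeps the weight and raises the second digit. -/
theorem Holds.cases {q : ℕ} (h : I.Holds q) : I.IsSingle q ∨
    (∃ q₁ < q, I.IsSwitch q₁ q ∧ I.Holds q₁) ∨
    ∃ q₁ < q, ∃ q₂ < q, I.IsJoin q₁ q₂ q ∧ I.Holds q₁ ∧ I.Holds q₂ := by
  have hw : ∀ u : Fin n, 0 < userWeight n u := fun u => by unfold userWeight; positivity
  unfold Holds at h
  generalize hv : Fin.ofNat n q = v at h
  generalize hc : Fin.ofNat k (q / n) = c at h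
  generalize hb : q / n / k % k = b at h
  generalize hX : q / n / k / k = X at h
  cases h with
  | single h1 h2 =>
    subst hv hc
    exact .inl ⟨h1, h2, hb, hX⟩
  | @switch _ c' _ b' _ h h1 h2 h3 =>
    subst hv hc
    obtain ⟨q₁, hv₁, hc₁, hb₁, hX₁⟩ := exists_number (Fin.ofNat n q) c' X (Nat.lt_of_succ_lt h3)
    refine .inr (.inl ⟨q₁, lt_of_switches_lt (hX₁.trans hX.symm) (by omega),
      ⟨congrArg Fin.val hv₁, hX₁.trans hX.symm, by omega, h1, by omega⟩, ?_⟩)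
    rwa [Holds, hv₁, hc₁, hb₁, hX₁]
  | @join _ u _ _ b' X₁ X₂ h h' hadj =>
    subst hv hc
    have p₁ := h.pos hw
    have p₂ := h'.pos hw
    obtain ⟨q₁, hv₁, hc₁, hb₁, hX₁⟩ :=
      exists_number (Fin.ofNat n q) (Fin.ofNat k (q / n)) X₁ (h.lt (NeZero.pos k))
    obtain ⟨q₂, hv₂, hc₂, hb₂, hX₂⟩ :=
      exists_number u (Fin.ofNat k (q / n)) X₂ (h'.lt (NeZero.pos k))
    refine .inr (.inr ⟨q₁, lt_of_weight_lt (n := n) (k := k) (by omega), q₂,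
      lt_of_weight_lt (n := n) (k := k) (by omega),
      ⟨congrArg Fin.val hv₁, congrArg Fin.val hc₁, congrArg Fin.val hc₂, by omega, by omega,
        hv₂ ▸ hadj⟩, ?_, ?_⟩)
    · rwa [Holds, hv₁, hc₁, hb₁, hX₁]
    · rwa [Holds, hv₂, hc₂, hb₂, hX₂]

/-- The number of facts about weights up to the total weight. -/
def factCount (n k : ℕ) : ℕ := (totalWeight n + 1) * k * k * n

theorem lt_factCount_iff {q : ℕ} : q < factCount n k ↔ q / n / k / k ≤ totalWeight n := by
  have hn := NeZero.pos n
  have hk := NeZero.pos k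
  rw [factCount, ← Nat.div_lt_iff_lt_mul hn, ← Nat.div_lt_iff_lt_mul hk,
    ← Nat.div_lt_iff_lt_mul hk, Nat.lt_succ_iff]

theorem connectable_iff_exists_holds (hn : 2 ≤ n) : I.Connectable ↔
    ∃ q < factCount n k, I.Holds q ∧ q / n / k / k = totalWeight n := by
  constructor
  · intro h
    obtain ⟨v, c, b, h⟩ := h.exists_gathers hn
    obtain ⟨q, hv, hc, hb, hX⟩ := exists_number v c (totalWeight n) (h.lt (NeZero.pos k))
    exact ⟨q, lt_factCount_iff.2 hX.le, by rwa [Holds, hv, hc, hb, hX], hX⟩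
  · rintro ⟨q, -, h, hX⟩
    rw [Holds, hX] at h
    exact h.connectable

end Facts

/-! ### The input -/

theorem inputState_adj {n k : ℕ} (I : CognitiveRadioNetwork (Fin n) (Fin k)) (u v : Fin n) :
    1 ≤ I.inputState.arr 0 (u * n + v) ↔ I.potentialGraph.Adj u v := by
  have : (∃ u' v' : Fin n, (u * n + v : ℕ) = u' * n + v' ∧ I.potentialGraph.Adj u' v') ↔
      I.potentialGraph.Adj u v := by
    refine ⟨?_, fun h => ⟨u, v, rfl, h⟩⟩
    rintro ⟨u', v', h, hadj⟩
    have hv : v = v' := Fin.ext (by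
      simpa [Nat.mod_eq_of_lt u.2, Nat.mod_eq_of_lt v.2, Nat.mod_eq_of_lt v'.2] using
        congrArg (· % n) h)
    subst hv
    have hu : u = u' := Fin.ext (Nat.eq_of_mul_eq_mul_right v.pos (Nat.add_right_cancel h))
    exact hu ▸ hadj
  simp only [inputState, if_true, this]
  split_ifs <;> simp_all

theorem inputState_spec {n k : ℕ} (I : CognitiveRadioNetwork (Fin n) (Fin k)) (u : Fin n)
    (c : Fin k) : 1 ≤ I.inputState.arr 1 (u * k + c) ↔ c ∈ I.specMap u := by
  have : (∃ (u' : Fin n) (c' : Fin k), (u * k + c : ℕ) = u' * k + c' ∧ c' ∈ I.specMap u') ↔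
      c ∈ I.specMap u := by
    refine ⟨?_, fun h => ⟨u, c, rfl, h⟩⟩
    rintro ⟨u', c', h, hc⟩
    have hv : c = c' := Fin.ext (by
      simpa [Nat.mod_eq_of_lt c.2, Nat.mod_eq_of_lt c'.2] using congrArg (· % k) h)
    subst hv
    have hu : u = u' := Fin.ext (Nat.eq_of_mul_eq_mul_right c.pos (Nat.add_right_cancel h))
    exact hu ▸ hc
  simp only [inputState, if_true, one_ne_zero, if_false, this]
  split_ifs <;> simp_all

theorem inputState_budget {n k : ℕ} (I : CognitiveRadioNetwork (Fin n) (Fin k)) (u : Fin n) :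
    I.inputState.arr 2 u = I.budget u := by
  simp [inputState]

end CognitiveRadioNetwork

/-! ### The program -/

namespace RAM

/-- `a - b + (b - a)`, which is zero if and only if `a` and `b` have the same value. -/
def Expr.dist (a b : Expr) : Expr := .add (.sub a b) (.sub b a)

theorem Expr.value_dist {s : State} {a b : Expr} :
    (Expr.dist a b).value s = 0 ↔ a.value s = b.value s := by
  simp only [Expr.dist, Expr.value]; omega

/-- `1 - a`, which is zero if and only if the value of `a` is not zero. -/
def Expr.not (a : Expr) : Expr := .sub (.const 1) a

theorem Expr.value_not {s : State} {a : Expr} : a.not.value s = 0 ↔ 1 ≤ a.value s := by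
  simp only [Expr.not, Expr.value]; omega

theorem Expr.value_sub {s : State} {a b : Expr} :
    (Expr.sub a b).value s = 0 ↔ a.value s ≤ b.value s := by
  simp only [Expr.value]; omega

/-- With zero as the value of success, addition is the conjunction of tests. -/
theorem Expr.value_add {s : State} {a b : Expr} :
    (Expr.add a b).value s = 0 ↔ a.value s = 0 ∧ b.value s = 0 := by
  simp only [Expr.value]; omega

end RAM

namespace CognitiveRadioNetwork

open RAM

/-- Compute `2 ^ n` in register 2, and the multiples of `n` and `k` and the powers of two in the
arrays 3, 4 and 5. -/
def powersProgram : Program :=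
  .seq (.assign 2 (.const 1)) (.forLoop 6 0
    (.seq (.store 3 (.reg 6) (.reg 13)) (.seq (.store 4 (.reg 6) (.reg 14))
    (.seq (.store 5 (.reg 6) (.reg 2)) (.seq (.assign 13 (.add (.reg 13) (.reg 0)))
    (.seq (.assign 14 (.add (.reg 14) (.reg 1))) (.assign 2 (.add (.reg 2) (.reg 2)))))))))

/-- Compute the weights of the users in array 5 and their sum in register 3. -/
def weightsProgram : Program :=
  .seq (.forLoop 6 0
    (.seq (.store 5 (.reg 6) (.add (.reg 2) (.get 5 (.reg 6))))
      (.assign 3 (.add (.reg 3) (.get 5 (.reg 6))))))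
    (.assign 4 (.add (.reg 3) (.const 1)))

/-- List the facts: the weight, the number of switches, the channel and the user of fact `q`
are stored in cell `q` of the arrays 6, 7, 8 and 9. -/
def listProgram : Program :=
  .forLoop 6 4 (.forLoop 7 1 (.forLoop 8 1 (.forLoop 9 0
    (.seq (.store 6 (.reg 5) (.reg 6)) (.seq (.store 7 (.reg 5) (.reg 7))
    (.seq (.store 8 (.reg 5) (.reg 8)) (.seq (.store 9 (.reg 5) (.reg 9))
    (.assign 5 (.add (.reg 5) (.const 1))))))))))

/-- A test for the channel of the fact in register 10 being in the spectrum map of its user. -/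
def specTest : Expr :=
  .not (.get 1 (.add (.get 4 (.get 9 (.reg 10))) (.get 8 (.reg 10))))

/-- A test for `IsSingle`. -/
def singleTest : Expr :=
  .add specTest (.add (.not (.get 2 (.get 9 (.reg 10)))) (.add (.get 7 (.reg 10))
    (.dist (.get 6 (.reg 10)) (.get 5 (.get 9 (.reg 10))))))

/-- A test for `IsSwitch`, with the premise in register 11 being marked. -/
def switchTest : Expr :=
  .add (.not (.get 10 (.reg 11))) (.add (.dist (.get 9 (.reg 11)) (.get 9 (.reg 10)))
    (.add (.dist (.get 6 (.reg 11)) (.get 6 (.reg 10)))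
    (.add (.dist (.get 7 (.reg 10)) (.add (.get 7 (.reg 11)) (.const 1)))
    (.add specTest
      (.sub (.add (.get 7 (.reg 10)) (.const 1)) (.get 2 (.get 9 (.reg 10))))))))

/-- A test for `IsJoin`, with the premises in registers 11 and 12 being marked. -/
def joinTest : Expr :=
  .add (.not (.get 10 (.reg 11))) (.add (.not (.get 10 (.reg 12)))
    (.add (.dist (.get 9 (.reg 11)) (.get 9 (.reg 10)))
    (.add (.dist (.get 8 (.reg 11)) (.get 8 (.reg 10)))
    (.add (.dist (.get 8 (.reg 12)) (.get 8 (.reg 10)))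
    (.add (.dist (.get 7 (.reg 11)) (.get 7 (.reg 10)))
    (.add (.dist (.get 6 (.reg 10)) (.add (.get 6 (.reg 11)) (.get 6 (.reg 12))))
      (.not (.get 0 (.add (.get 3 (.get 9 (.reg 10))) (.get 9 (.reg 12)))))))))))

/-- Mark the fact in register 10, in array 10, if the test has the value zero. -/
def markIf (e : Expr) : Program := .ite e .skip (.store 10 (.reg 10) (.const 1))

/-- Mark all facts that hold, in the order of their numbers. -/
def markProgram : Program :=
  .forLoop 10 5 (.seq (markIf singleTest)
    (.forLoop 11 5 (.seq (markIf switchTest) (.forLoop 12 5 (markIf joinTest)))))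

/-- Look for a marked fact about the total weight. -/
def searchProgram : Program :=
  .seq (.forLoop 10 5 (.ite (.add (.not (.get 10 (.reg 10))) (.dist (.get 6 (.reg 10)) (.reg 3)))
    .skip (.assign 15 (.const 1)))) (.assign 0 (.reg 15))

/-- The program that decides whether a network is connectable. -/
def connectivityProgram : Program :=
  .ite (.sub (.reg 0) (.const 1))
    (.ite (.reg 1)
      (.seq powersProgram (.seq weightsProgram (.seq listProgram
        (.seq markProgram searchProgram))))
      (.assign 0 (.const 0)))
    .skip

/-! ### Correctness of the tables and of the list of facts -/

section Correctness

variable {n k : ℕ} (I : CognitiveRadioNetwork (Fin n) (Fin k))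

/-- The state still holds the input. -/
structure HasInput (s : State) : Prop where
  users : s.reg 0 = n
  channels : s.reg 1 = k
  adj : s.arr 0 = I.inputState.arr 0
  spec : s.arr 1 = I.inputState.arr 1
  budget : s.arr 2 = I.inputState.arr 2

/-- The state in the course of `powersProgram`. -/
structure PowersInv (j : ℕ) (s : State) : Prop extends HasInput I s where
  pow : s.reg 2 = 2 ^ j
  mulUsers : s.reg 13 = j * n
  mulChannels : s.reg 14 = j * k
  rows : ∀ v < j, s.arr 3 v = v * n ∧ s.arr 4 v = v * k ∧ s.arr 5 v = 2 ^ v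
  total : s.reg 3 = 0
  count : s.reg 5 = 0
  result : s.reg 15 = 0
  unmarked : ∀ q, s.arr 10 q = 0

theorem powersProgram_runs :
    Runs powersProgram I.inputState (n * 35 + 8) (PowersInv I n) := by
  refine (Runs.seq (R := PowersInv I 0) (.assign ?_) fun s hs =>
    Runs.forLoop (T := 27) (N := n) (fun j s h => h.users) ?_ ?_ hs).mono
      (by simp only [Expr.cost]; omega) fun _ h => h
  · constructor <;> simp [State.setReg, Expr.value, inputState]
    constructor <;> simp [inputState]
  · rintro j s v ⟨⟨h1, h2, h3, h4, h5⟩, h6, h7, h8, h9, h10, h11, h12, h13⟩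
    constructor <;> simp_all [State.setReg]
    constructor <;> simp_all
  · rintro j hj s ⟨⟨h1, h2, h3, h4, h5⟩, h6, h7, h8, h9, h10, h11, h12, h13⟩ hi
    refine (Runs.store_seq (.store_seq (.store_seq (.assign_seq (.assign_seq (.assign ?_)))))).mono
      (by simp [Expr.cost]) fun _ h => h
    refine ⟨⟨⟨?_, ?_, ?_, ?_, ?_⟩, ?_, ?_, ?_, fun v hv => ?_, ?_, ?_, ?_, ?_⟩, ?_⟩ <;>
      simp [State.setReg, State.setArr, Expr.value, *]
    · ring
    · ring
    · ring
    · by_cases hvj : v = j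
      · simp [hvj]
      · simpa [hvj, Function.update] using h9 v (by omega)

/-- The state in the course of `weightsProgram`. -/
structure WeightsInv (j : ℕ) (s : State) : Prop extends HasInput I s where
  pow : s.reg 2 = 2 ^ n
  rows : ∀ v < n, s.arr 3 v = v * n ∧ s.arr 4 v = v * k
  weights : ∀ v < n, s.arr 5 v = if v < j then userWeight n v else 2 ^ v
  total : s.reg 3 = ∑ u ∈ Finset.range j, userWeight n u
  count : s.reg 5 = 0
  result : s.reg 15 = 0
  unmarked : ∀ q, s.arr 10 q = 0

/-- The tables that `powersProgram` and `weightsProgram` compute, and the list of the first `q`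
facts. -/
structure HasFacts (q : ℕ) (s : State) : Prop extends HasInput I s where
  rows : ∀ v < n, s.arr 3 v = v * n ∧ s.arr 4 v = v * k ∧ s.arr 5 v = userWeight n v
  total : s.reg 3 = totalWeight n
  count : s.reg 5 = q
  facts : ∀ p < q, s.arr 6 p = p / n / k / k ∧ s.arr 7 p = p / n / k % k ∧
    s.arr 8 p = p / n % k ∧ s.arr 9 p = p % n

/-- No fact is marked yet. -/
structure Unmarked (s : State) : Prop where
  result : s.reg 15 = 0
  unmarked : ∀ q, s.arr 10 q = 0

theorem weightsProgram_runs {s : State} (hs : PowersInv I n s) :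
    Runs weightsProgram s (n * 23 + 10)
      fun s => HasFacts I 0 s ∧ Unmarked s ∧ s.reg 4 = totalWeight n + 1 := by
  refine (Runs.seq (R := WeightsInv I n) (Runs.forLoop (P := WeightsInv I) (T := 15) (N := n)
    (fun j s h => h.users) ?_ ?_ ?_) fun s hs => .assign ?_).mono
      (by simp only [Expr.cost]; omega) fun _ h => h
  · rintro j s v ⟨⟨h1, h2, h3, h4, h5⟩, h6, h7, h8, h9, h10, h11, h12⟩
    refine ⟨⟨?_, ?_, ?_, ?_, ?_⟩, ?_, ?_, ?_, ?_, ?_, ?_, ?_⟩ <;> simp_all [State.setReg]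
  · rintro j hj s ⟨⟨h1, h2, h3, h4, h5⟩, h6, h7, h8, h9, h10, h11, h12⟩ hi
    refine (Runs.store_seq (.assign ?_)).mono (by simp [Expr.cost]) fun _ h => h
    have h8j := h8 j hj
    refine ⟨⟨⟨?_, ?_, ?_, ?_, ?_⟩, ?_, fun v hv => ?_, fun v hv => ?_, ?_, ?_, ?_, ?_⟩, ?_⟩ <;>
      simp [State.setReg, State.setArr, Expr.value, *]
    · by_cases hvj : v = j
      · simp [hvj, userWeight]
      · simp [hvj, h8 v hv, show v ≤ j ↔ v < j by omega]
    · rw [Finset.sum_range_succ, userWeight]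
  · obtain ⟨⟨h1, h2, h3, h4, h5⟩, h6, h7, h8, h9, h10, h11, h12, h13⟩ := hs
    refine ⟨⟨h1, h2, h3, h4, h5⟩, h6, fun v hv => ⟨(h9 v hv).1, (h9 v hv).2.1⟩,
      fun v hv => by simpa using (h9 v hv).2.2, by simpa using h10, h11, h12, h13⟩
  · obtain ⟨⟨h1, h2, h3, h4, h5⟩, h6, h7, h8, h9, h10, h11, h12⟩ := hs
    refine ⟨⟨⟨?_, ?_, ?_, ?_, ?_⟩, fun v hv => ⟨?_, ?_, ?_⟩, ?_, ?_, ?_⟩, ⟨?_, ?_⟩, ?_⟩ <;>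
      simp_all [State.setReg, Expr.value, totalWeight]

/-- The state in the course of `listProgram`, when the first `q` facts have been listed. -/
structure ListInv (q : ℕ) (s : State) : Prop extends HasFacts I q s, Unmarked s where
  bound : s.reg 4 = totalWeight n + 1

variable {I} in
theorem ListInv.setReg {q : ℕ} {s : State} (h : ListInv I q s) (x v : ℕ)
    (hx : x ∈ Finset.Icc 6 9) : ListInv I q (s.setReg x v) := by
  obtain ⟨⟨⟨h1, h2, h3, h4, h5⟩, h6, h7, h8, h9⟩, ⟨h10, h11⟩, h12⟩ := h
  rw [Finset.mem_Icc] at hx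
  have hne : ∀ y, y < 6 ∨ 9 < y → (s.setReg x v).reg y = s.reg y := fun y hy =>
    Function.update_of_ne (by omega) _ _
  refine ⟨⟨⟨?_, ?_, h3, h4, h5⟩, h6, ?_, ?_, h9⟩, ⟨?_, h11⟩, ?_⟩ <;> rw [hne _ (by omega)] <;>
    assumption

/-- The nested loops run through the digits in lexicographic order, so the running counter in
register 5 is the fact number, and the digits are found without division. -/
theorem listProgram_runs {s : State} (hs : ListInv I 0 s) :
    Runs listProgram s
      ((totalWeight n + 1) * (k * (k * (n * 32 + 14) + 14) + 14) + 6)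
      (ListInv I (factCount n k)) := by
  refine (Runs.forLoop (P := fun j s => ListInv I (j * k * k * n) s) (i := 6) (m := 4)
    (N := totalWeight n + 1) (fun j s h => h.bound) (fun j s v h => h.setReg _ _ (by simp))
    (T := k * (k * (n * 32 + 14) + 14) + 6) ?_ (by simpa using hs)).mono le_rfl fun _ h => h
  intro X hX s hs h6
  refine (Runs.forLoop (P := fun j s => ListInv I ((X * k + j) * k * n) s ∧ s.reg 6 = X)
    (i := 7) (m := 1) (N := k) (fun j s h => h.1.channels)
    (fun j s v h => ⟨h.1.setReg _ _ (by simp), by simpa [State.setReg] using h.2⟩)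
    (T := k * (n * 32 + 14) + 6) ?_ ⟨by simpa using hs, h6⟩).mono le_rfl
      fun s h => ⟨by rw [Nat.add_mul, Nat.one_mul]; exact h.1, h.2⟩
  intro b hb s hs h7
  refine (Runs.forLoop (P := fun j s => ListInv I (((X * k + b) * k + j) * n) s ∧ s.reg 6 = X ∧
      s.reg 7 = b)
    (i := 8) (m := 1) (N := k) (fun j s h => h.1.channels)
    (fun j s v h => ⟨h.1.setReg _ _ (by simp), by simpa [State.setReg] using h.2⟩)
    (T := n * 32 + 6) ?_ ⟨by simpa using hs.1, hs.2, h7⟩).mono le_rfl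
      fun s h => ⟨⟨by
        rw [← add_assoc, Nat.add_mul _ 1, Nat.one_mul]; exact h.1, h.2.1⟩, h.2.2⟩
  intro c hc s hs h8
  refine (Runs.forLoop (P := fun j s => ListInv I (((X * k + b) * k + c) * n + j) s ∧
      s.reg 6 = X ∧ s.reg 7 = b ∧ s.reg 8 = c)
    (i := 9) (m := 0) (N := n) (fun j s h => h.1.users)
    (fun j s v h => ⟨h.1.setReg _ _ (by simp), by simpa [State.setReg] using h.2⟩)
    (T := 24) ?_ ⟨by simpa using hs.1, hs.2.1, hs.2.2, h8⟩).mono le_rfl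
      fun s h => ⟨⟨by
        rw [← add_assoc, Nat.add_mul _ 1, Nat.one_mul]; exact h.1, h.2.1, h.2.2.1⟩, h.2.2.2⟩
  rintro v hv s ⟨⟨⟨⟨h1, h2, h3, h4, h5⟩, h6, h7, h8, h9⟩, ⟨h10, h11⟩, h12⟩, hX', hb', hc'⟩ hi
  refine (Runs.store_seq (.store_seq (.store_seq (.store_seq (.assign ?_))))).mono
    (by simp [Expr.cost]) fun _ h => h
  have e1 : (((X * k + b) * k + c) * n + v) / n = (X * k + b) * k + c := by
    rw [mul_comm _ n, Nat.mul_add_div (by omega), Nat.div_eq_of_lt hv, add_zero]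
  have e2 : ((X * k + b) * k + c) / k = X * k + b := by
    rw [mul_comm _ k, Nat.mul_add_div (by omega), Nat.div_eq_of_lt hc, add_zero]
  have e3 : (X * k + b) / k = X := by
    rw [mul_comm _ k, Nat.mul_add_div (by omega), Nat.div_eq_of_lt hb, add_zero]
  refine ⟨⟨⟨⟨⟨?_, ?_, ?_, ?_, ?_⟩, ?_, ?_, ?_, fun p hp => ?_⟩, ⟨?_, ?_⟩, ?_⟩, ?_, ?_, ?_⟩, ?_⟩ <;>
    simp only [State.setReg, State.setArr, Expr.value, Function.update_apply, Nat.reduceEqDiff,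
      if_false, if_true, h8, hi, hX', hb', hc'] <;>
    try assumption
  · rfl
  · by_cases hpq : p = ((X * k + b) * k + c) * n + v
    · simp [hpq, e1, e2, e3, Nat.mod_eq_of_lt, hv, hc, hb]
    · simpa [hpq] using h9 p (by omega)

end Correctness

end CognitiveRadioNetwork

namespace CognitiveRadioNetwork

open RAM

/-! ### Correctness of marking and searching -/

section Marking

variable {n k : ℕ} [NeZero n] {I : CognitiveRadioNetwork (Fin n) (Fin k)}

theorem HasFacts.budget_get {L q : ℕ} {s : State} (h : HasFacts I L s) (hqL : q < L) :
    s.arr 2 (s.arr 9 q) = I.budget (Fin.ofNat n q) := by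
  rw [(h.facts q hqL).2.2.2, ← inputState_budget, h.budget, Fin.val_ofNat]

theorem HasFacts.joinTest {L q q₁ q₂ : ℕ} {s : State} (h : HasFacts I L s) (hq : s.reg 10 = q)
    (hq₁ : s.reg 11 = q₁) (hq₂ : s.reg 12 = q₂) (hqL : q < L) (hqL₁ : q₁ < L) (hqL₂ : q₂ < L) :
    joinTest.value s = 0 ↔ 1 ≤ s.arr 10 q₁ ∧ 1 ≤ s.arr 10 q₂ ∧ I.IsJoin q₁ q₂ q := by
  obtain ⟨h6, h7, h8, h9⟩ := h.facts q hqL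
  obtain ⟨h6', h7', h8', h9'⟩ := h.facts q₁ hqL₁
  obtain ⟨h6'', -, h8'', h9''⟩ := h.facts q₂ hqL₂
  have h3 := (h.rows _ (Nat.mod_lt q (NeZero.pos n))).1
  have hadj := inputState_adj I (Fin.ofNat n q) (Fin.ofNat n q₂)
  simp only [Fin.val_ofNat] at hadj
  simp only [CognitiveRadioNetwork.joinTest, Expr.value_add, Expr.value_not, Expr.value_dist,
    IsJoin]
  simp only [Expr.value, hq, hq₁, hq₂, h6, h7, h8, h9, h6', h7', h8', h9', h6'', h8'', h9'', h3,
    h.adj, hadj]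

variable [NeZero k]

theorem HasFacts.specTest {L q : ℕ} {s : State} (h : HasFacts I L s) (hq : s.reg 10 = q)
    (hqL : q < L) :
    specTest.value s = 0 ↔ Fin.ofNat k (q / n) ∈ I.specMap (Fin.ofNat n q) := by
  obtain ⟨-, -, h8, h9⟩ := h.facts q hqL
  have h4 := (h.rows _ (Nat.mod_lt q (NeZero.pos n))).2.1
  rw [CognitiveRadioNetwork.specTest, Expr.value_not, ← inputState_spec]
  simp only [Expr.value, hq, h8, h9, h4, h.spec, Fin.val_ofNat]

theorem HasFacts.singleTest {L q : ℕ} {s : State} (h : HasFacts I L s) (hq : s.reg 10 = q)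
    (hqL : q < L) : singleTest.value s = 0 ↔ I.IsSingle q := by
  have hβ := h.budget_get hqL
  obtain ⟨h6, h7, -, h9⟩ := h.facts q hqL
  have h5 := (h.rows _ (Nat.mod_lt q (NeZero.pos n))).2.2
  simp only [CognitiveRadioNetwork.singleTest, Expr.value_add, h.specTest hq hqL, Expr.value_not,
    Expr.value_dist, IsSingle]
  simp only [Expr.value, hq, hβ]
  simp only [h6, h7, h9, h5]

theorem HasFacts.switchTest {L q q₁ : ℕ} {s : State} (h : HasFacts I L s) (hq : s.reg 10 = q)
    (hq₁ : s.reg 11 = q₁) (hqL : q < L) (hqL₁ : q₁ < L) :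
    switchTest.value s = 0 ↔ 1 ≤ s.arr 10 q₁ ∧ I.IsSwitch q₁ q := by
  have hβ := h.budget_get hqL
  obtain ⟨h6, h7, -, h9⟩ := h.facts q hqL
  obtain ⟨h6', h7', -, h9'⟩ := h.facts q₁ hqL₁
  simp only [CognitiveRadioNetwork.switchTest, Expr.value_add, h.specTest hq hqL, Expr.value_not,
    Expr.value_dist, Expr.value_sub, IsSwitch]
  simp only [Expr.value, hq, hq₁, hβ]
  simp only [h6, h7, h9, h6', h7', h9']

variable (I) in
/-- The state in the course of `markProgram`: only facts that hold are marked, and all facts in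
`S` are. -/
structure MarkInv (S : ℕ → Prop) (s : State) : Prop extends HasFacts I (factCount n k) s where
  result : s.reg 15 = 0
  sound : ∀ q, 1 ≤ s.arr 10 q → I.Holds q
  marked : ∀ q, S q → 1 ≤ s.arr 10 q

theorem MarkInv.mono {S S' : ℕ → Prop} {s : State} (h : MarkInv I S s) (hS : ∀ q, S' q → S q) :
    MarkInv I S' s :=
  { h with marked := fun q hq => h.marked q (hS q hq) }

theorem MarkInv.setReg {S : ℕ → Prop} {s : State} (h : MarkInv I S s) (x v : ℕ)
    (hx : x ∈ Finset.Icc 10 12) : MarkInv I S (s.setReg x v) := by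
  obtain ⟨⟨⟨h1, h2, h3, h4, h5⟩, h6, h7, h8, h9⟩, h10, h11, h12⟩ := h
  rw [Finset.mem_Icc] at hx
  have hne : ∀ y, y < 10 ∨ 12 < y → (s.setReg x v).reg y = s.reg y := fun y hy =>
    Function.update_of_ne (by omega) _ _
  refine ⟨⟨⟨?_, ?_, h3, h4, h5⟩, h6, ?_, ?_, h9⟩, ?_, h11, h12⟩ <;> rw [hne _ (by omega)] <;>
    assumption

theorem MarkInv.mark {S : ℕ → Prop} {s : State} {q : ℕ} (h : MarkInv I S s) (hq : I.Holds q) :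
    MarkInv I (fun p => S p ∨ p = q) (s.setArr 10 q 1) := by
  obtain ⟨⟨⟨h1, h2, h3, h4, h5⟩, h6, h7, h8, h9⟩, h10, h11, h12⟩ := h
  have hne : ∀ a, a < 10 → (s.setArr 10 q 1).arr a = s.arr a := fun a ha =>
    Function.update_of_ne (by omega) _ _
  refine ⟨⟨⟨h1, h2, ?_, ?_, ?_⟩, ?_, h7, h8, ?_⟩, h10, fun p hp => ?_, fun p hp => ?_⟩
  · rw [hne _ (by omega), h3]
  · rw [hne _ (by omega), h4]
  · rw [hne _ (by omega), h5]
  · rwa [hne 3 (by omega), hne 4 (by omega), hne 5 (by omega)]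
  · rwa [hne 6 (by omega), hne 7 (by omega), hne 8 (by omega), hne 9 (by omega)]
  · by_cases hpq : p = q
    · exact hpq ▸ hq
    · exact h11 p (by simpa [State.setArr, hpq] using hp)
  · by_cases hpq : p = q
    · simp [State.setArr, hpq]
    · simpa [State.setArr, hpq] using h12 p (hp.resolve_right hpq)

theorem MarkInv.markIf {S S' : ℕ → Prop} {s : State} {q : ℕ} {e : Expr} (h : MarkInv I S s)
    (hq : s.reg 10 = q) (he : e.value s = 0 → I.Holds q)
    (hS : ∀ p, S' p → S p ∨ p = q ∧ e.value s = 0) :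
    Runs (markIf e) s (e.cost + 4) fun s' => MarkInv I S' s' ∧ s'.reg = s.reg := by
  refine Runs.ite (T := 3) (fun hv => (Runs.skip (Q := fun s' =>
    MarkInv I S' s' ∧ s'.reg = s.reg) ⟨h.mono fun p hp => ?_, rfl⟩).mono (by omega)
      fun _ h => h) fun hv => .store ⟨?_, rfl⟩
  · exact (hS p hp).resolve_right fun h => hv h.2
  · simp only [Expr.value, hq]
    exact (h.mark (he hv)).mono fun p hp => (hS p hp).imp_right And.left

variable (I) in
/-- Fact `q` follows from fact `q₁`, and a fact with a number less than `j`. -/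
def FollowsBelow (j q₁ q : ℕ) : Prop :=
  q₁ < q ∧ I.Holds q₁ ∧ ∃ q₂ < j, q₂ < q ∧ I.Holds q₂ ∧ I.IsJoin q₁ q₂ q

variable (I) in
/-- Fact `q` follows from fact `q₁`, and possibly further facts with numbers less than `q`. -/
def Follows (q₁ q : ℕ) : Prop :=
  q₁ < q ∧ I.Holds q₁ ∧ I.IsSwitch q₁ q ∨ FollowsBelow I q q₁ q

variable (I) in
/-- The facts that are marked when the outer loop of `markProgram` has come to fact `q`, and the
middle one to fact `j`. -/
def MarkedBelow (j q p : ℕ) : Prop :=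
  p < q ∧ I.Holds p ∨ p = q ∧ (I.IsSingle q ∨ ∃ q₁ < j, Follows I q₁ q)

/-- Soundness holds for premises of any number. Completeness uses only premises below `q`, which
earlier rounds of the outer loop have marked. -/
theorem markProgram_runs {s : State} (hs : MarkInv I (fun _ => False) s) :
    Runs markProgram s
      (factCount n k * (factCount n k * (factCount n k * 97 + 81) + 50) + 6)
      (MarkInv I fun q => q < factCount n k ∧ I.Holds q) := by
  refine (Runs.forLoop (P := fun j => MarkInv I fun q => q < j ∧ I.Holds q) (i := 10) (m := 5)
    (N := factCount n k) (fun j s h => h.count) (fun j s v h => h.setReg _ _ (by simp))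
    (T := factCount n k * (factCount n k * 97 + 81) + 42) ?_
    (hs.mono (by simp))).mono (by simp [add_assoc]) fun _ h => h
  intro q hq s hs h10
  refine (Runs.seq (R := fun s' => MarkInv I (MarkedBelow I 0 q) s' ∧ s'.reg 10 = q)
    ((hs.markIf (S' := MarkedBelow I 0 q) h10 (fun h => ?_) fun p hp => ?_).mono le_rfl
      fun s' h => ⟨h.1, by rw [h.2, h10]⟩) fun s' hs' => Runs.forLoop
    (P := fun j s => MarkInv I (MarkedBelow I j q) s ∧ s.reg 10 = q)
    (N := factCount n k) (fun j s h => h.1.count)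
    (fun j s v h => ⟨h.1.setReg _ _ (by simp), by simpa [State.setReg] using h.2⟩)
    (T := factCount n k * 97 + 73) ?_ hs').mono ?_ ?_
  · exact ((hs.singleTest h10 hq).1 h).holds
  · rcases hp with hp | ⟨rfl, hp | ⟨_, h, _⟩⟩
    · exact .inl hp
    · exact .inr ⟨rfl, (hs.singleTest h10 hq).2 hp⟩
    · omega
  · rintro q₁ hq₁ s ⟨hs, h10⟩ h11
    refine (Runs.seq (R := fun s' => MarkInv I (fun p => MarkedBelow I q₁ q p ∨ p = q ∧
        (q₁ < q ∧ I.Holds q₁ ∧ I.IsSwitch q₁ q ∨ FollowsBelow I 0 q₁ q)) s' ∧ s'.reg 10 = q ∧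
          s'.reg 11 = q₁)
      ((hs.markIf h10 (fun h => ?_) fun p hp => ?_).mono le_rfl
        fun s' h => ⟨h.1, by rw [h.2, h10], by rw [h.2, h11]⟩) fun s' hs' => Runs.forLoop
      (P := fun j s => MarkInv I (fun p => MarkedBelow I q₁ q p ∨ p = q ∧
        (q₁ < q ∧ I.Holds q₁ ∧ I.IsSwitch q₁ q ∨ FollowsBelow I j q₁ q)) s ∧ s.reg 10 = q ∧
          s.reg 11 = q₁)
      (N := factCount n k) (fun j s h => h.1.count)
      (fun j s v h => ⟨h.1.setReg _ _ (by simp), by simpa [State.setReg] using h.2⟩)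
      (T := 89) ?_ hs').mono ?_ ?_
    · obtain ⟨h1, h2⟩ := (hs.switchTest h10 h11 hq hq₁).1 h
      exact h2.holds (hs.sound _ h1)
    · rcases hp with hp | ⟨rfl, ⟨h1, h2, h3⟩ | ⟨_, _, _, h, _⟩⟩
      · exact .inl hp
      · exact .inr ⟨rfl, (hs.switchTest h10 h11 hq hq₁).2
          ⟨hs.marked _ (.inl ⟨h1, h2⟩), h3⟩⟩
      · omega
    · rintro q₂ hq₂ s ⟨hs, h10, h11⟩ h12
      refine (hs.markIf h10 (fun h => ?_) fun p hp => ?_).mono ?_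
        fun s' h => ⟨⟨h.1, by rw [h.2, h10], by rw [h.2, h11]⟩, by rw [h.2, h12]⟩
      · obtain ⟨h1, h2, h3⟩ := (hs.joinTest h10 h11 h12 hq hq₁ hq₂).1 h
        exact h3.holds (hs.sound _ h1) (hs.sound _ h2)
      · rcases hp with hp | ⟨rfl, hp | ⟨h1, h2, q', h3, h4, h5, h6⟩⟩
        · exact .inl (.inl hp)
        · exact .inl (.inr ⟨rfl, .inl hp⟩)
        · rcases Nat.lt_succ_iff_lt_or_eq.1 h3 with h3 | rfl
          · exact .inl (.inr ⟨rfl, .inr ⟨h1, h2, q', h3, h4, h5, h6⟩⟩)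
          · exact .inr ⟨rfl, (hs.joinTest h10 h11 h12 hq hq₁ hq₂).2
              ⟨hs.marked _ (.inl (.inl ⟨h1, h2⟩)), hs.marked _ (.inl (.inl ⟨h4, h5⟩)), h6⟩⟩
      · decide
    · have : switchTest.cost = 63 := by decide
      omega
    · rintro s ⟨hs, h10, h11⟩
      refine ⟨⟨hs.mono fun p hp => ?_, h10⟩, h11⟩
      rcases hp with hp | ⟨rfl, hp | ⟨q', hq', hp⟩⟩
      · exact .inl (.inl hp)
      · exact .inl (.inr ⟨rfl, .inl hp⟩)
      · rcases Nat.lt_succ_iff_lt_or_eq.1 hq' with hq' | rfl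
        · exact .inl (.inr ⟨rfl, .inr ⟨q', hq', hp⟩⟩)
        -- The innermost loop has run over all of `factCount n k`, hence over every `q₂ < q`.
        · refine .inr ⟨rfl, hp.imp_right ?_⟩
          rintro ⟨h1, h2, q₂, h3, -, h5⟩
          exact ⟨h1, h2, q₂, h3.trans hq, h3, h5⟩
  · have : singleTest.cost = 32 := by decide
    simp only [add_assoc, Nat.reduceAdd]
    omega
  · rintro s ⟨hs, h10⟩
    refine ⟨hs.mono fun p ⟨hp, hp'⟩ => ?_, h10⟩
    rcases Nat.lt_succ_iff_lt_or_eq.1 hp with hp | rfl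
    · exact .inl ⟨hp, hp'⟩
    · refine .inr ⟨rfl, ?_⟩
      rcases hp'.cases with h | ⟨q₁, h1, h2, h3⟩ | ⟨q₁, h1, q₂, h2, h3, h4, h5⟩
      · exact .inl h
      · exact .inr ⟨q₁, h1.trans hq, .inl ⟨h1, h3, h2⟩⟩
      · exact .inr ⟨q₁, h1.trans hq, .inr ⟨h1, h4, q₂, h2, h2, h5, h3⟩⟩

open Classical in
theorem searchProgram_runs (hn : 2 ≤ n) {s : State}
    (hs : MarkInv I (fun q => q < factCount n k ∧ I.Holds q) s) :
    Runs searchProgram s (factCount n k * 26 + 8)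
      fun s => s.reg 0 = if I.Connectable then 1 else 0 := by
  let P (j : ℕ) (s : State) : Prop := HasFacts I (factCount n k) s ∧
    (∀ q < factCount n k, 1 ≤ s.arr 10 q ↔ I.Holds q) ∧
    s.reg 15 = if ∃ q < j, I.Holds q ∧ q / n / k / k = totalWeight n then 1 else 0
  refine (Runs.seq (R := P (factCount n k)) (Runs.forLoop (P := P) (T := 18)
    (N := factCount n k) (fun j s h => h.1.count) ?_ ?_ ?_) fun s hs => .assign ?_).mono
    (by simp only [Expr.cost]; omega) fun _ h => h
  · rintro j s v ⟨⟨⟨h1, h2, h3, h4, h5⟩, h6, h7, h8, h9⟩, h10, h11⟩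
    refine ⟨⟨⟨?_, ?_, ?_, ?_, ?_⟩, ?_, ?_, ?_, ?_⟩, ?_, ?_⟩ <;> simpa [State.setReg]
  · intro q hq s hs h10
    have hv : (Expr.add (.not (.get 10 (.reg 10)))
        (.dist (.get 6 (.reg 10)) (.reg 3))).value s = 0 ↔
        I.Holds q ∧ q / n / k / k = totalWeight n := by
      rw [Expr.value_add, Expr.value_not, Expr.value_dist]
      simp only [Expr.value, h10, hs.1.total, (hs.1.facts q hq).1, hs.2.1 q hq]
    obtain ⟨⟨⟨h1, h2, h3, h4, h5⟩, h6, h7, h8, h9⟩, h11, h12⟩ := hs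
    refine (Runs.ite (T := 2) (fun hne => (Runs.skip ?_).mono (by omega) fun _ h => h)
      fun heq => .assign ?_).mono (by decide) fun _ h => h
    · rw [Ne, hv] at hne
      refine ⟨⟨⟨⟨h1, h2, h3, h4, h5⟩, h6, h7, h8, h9⟩, h11, ?_⟩, h10⟩
      rw [h12]
      congr 1
      refine propext ⟨fun ⟨q', h, h'⟩ => ⟨q', by omega, h'⟩, fun ⟨q', h, h'⟩ => ⟨q', ?_, h'⟩⟩
      rcases Nat.lt_succ_iff_lt_or_eq.1 h with h | rfl
      · exact h
      · exact absurd h' hne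
    · rw [hv] at heq
      refine ⟨⟨⟨⟨?_, ?_, ?_, ?_, ?_⟩, ?_, ?_, ?_, ?_⟩, ?_, ?_⟩, ?_⟩
      -- Goal 11 is the flag in register 15; the other goals concern data left unchanged.
      on_goal 11 => rw [if_pos ⟨q, by omega, heq⟩]; rfl
      all_goals simpa [State.setReg, Expr.value]
  · refine ⟨hs.toHasFacts, fun q hq => ⟨hs.sound q, fun h => hs.marked q ⟨hq, h⟩⟩, ?_⟩
    simpa using hs.result
  · simp only [State.setReg, Expr.value, Function.update_self, hs.2.2,
      connectable_iff_exists_holds (I := I) hn]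

end Marking

end CognitiveRadioNetwork

/-! ### The time bound -/

namespace CognitiveRadioNetwork

open RAM

theorem factCount_le (n k : ℕ) : factCount n k ≤ 2 ^ (3 * (n + k)) := by
  have hn : n + 1 ≤ 2 ^ n := Nat.lt_two_pow_self
  have hk : k ≤ 2 ^ k := Nat.lt_two_pow_self.le
  calc factCount n k = (n + 1) * 2 ^ n * k * k * n := by rw [factCount, totalWeight_add_one]
    _ ≤ 2 ^ n * 2 ^ n * 2 ^ k * 2 ^ k * 2 ^ n := by gcongr; omega
    _ = 2 ^ (3 * n + 2 * k) := by ring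
    _ ≤ 2 ^ (3 * (n + k)) := Nat.pow_le_pow_right (by omega) (by omega)

theorem not_connectable_of_isEmpty {n : ℕ} {C : Type*} [IsEmpty C] (hn : 2 ≤ n)
    (I : CognitiveRadioNetwork (Fin n) C) : ¬ I.Connectable := by
  rintro ⟨SA, -, hG⟩
  have : Nontrivial (Fin n) := Fin.nontrivial_iff_two_le.2 hn
  obtain ⟨u, -, c, -⟩ := hG.preconnected.exists_adj_of_nontrivial ⟨0, by omega⟩
  exact isEmptyElim c

theorem connectable_of_unique {U C : Type*} [Unique U] (I : CognitiveRadioNetwork U C) :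
    I.Connectable :=
  ⟨fun _ => ∅, fun _ => by simp, ⟨.of_subsingleton⟩⟩

open Classical in
theorem connectivityProgram_runs_of_two_le {n k : ℕ} (hn : 2 ≤ n) (hk : 1 ≤ k)
    (I : CognitiveRadioNetwork (Fin n) (Fin k)) :
    Runs connectivityProgram I.inputState (2 ^ (18 * (n + k)))
      fun s => s.reg 0 = if I.Connectable then 1 else 0 := by
  have : NeZero n := ⟨by omega⟩
  have : NeZero k := ⟨by omega⟩
  have h0 : I.inputState.reg 0 = n := by simp [inputState]
  have h1 : I.inputState.reg 1 = k := by simp [inputState]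
  refine (Runs.ite (fun _ => Runs.ite (fun _ => (powersProgram_runs I).seq fun s hs =>
    (weightsProgram_runs I hs).seq fun s hs => (listProgram_runs I
      { hs.1, hs.2.1 with bound := hs.2.2 }).seq fun s hs =>
        (markProgram_runs { hs.toHasFacts with
          result := hs.result
          sound := fun q hq => by simp [hs.unmarked q] at hq
          marked := fun _ h => h.elim }).seq fun s hs => searchProgram_runs hn hs)
    fun h => ?_) fun h => ?_).mono ?_ fun _ h => h
  · simp only [Expr.value, h1] at h; omega
  · simp only [Expr.value, h0] at h; omega
  · simp only [Expr.cost]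
    have hlist : (totalWeight n + 1) * (k * (k * (n * 32 + 14) + 14) + 14) ≤
        74 * factCount n k := by
      -- Each overhead 14 is padded with factors that are at least 1, and `32 + 3 * 14 = 74`.
      calc (totalWeight n + 1) * (k * (k * (n * 32 + 14) + 14) + 14)
          ≤ (totalWeight n + 1) * (k * (k * (n * 32 + 14 * n) + 14 * (k * n)) +
              14 * (k * (k * n))) := by
            have h2 : 1 ≤ k * n := Nat.mul_pos hk (by omega)
            have h3 : 1 ≤ k * (k * n) := Nat.mul_pos hk h2
            gcongr <;> omega
        _ = 74 * factCount n k := by rw [factCount]; ring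
    have hnL : n ≤ factCount n k :=
      Nat.le_mul_of_pos_left _ (Nat.mul_pos (Nat.mul_pos (Nat.succ_pos _) hk) hk)
    have hpow : factCount n k ^ 3 ≤ 2 ^ (9 * (n + k)) :=
      (Nat.pow_le_pow_left (factCount_le n k) 3).trans_eq (by rw [← pow_mul]; ring_nf)
    -- All phases together take at most `2 ^ 9 * L ^ 3` steps for `L` facts; the constant `2 ^ 9` is
    -- absorbed by doubling the exponent.
    have h29 : 2 ^ 9 * 2 ^ (9 * (n + k)) ≤ 2 ^ (18 * (n + k)) := by
      rw [← pow_add]; exact Nat.pow_le_pow_right (by omega) (by omega)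
    generalize factCount n k = L at *
    have hL : 1 ≤ L := by omega
    have hL2 : L ≤ L ^ 2 := Nat.le_self_pow (by omega) _
    have hL3 : L ^ 2 ≤ L ^ 3 := Nat.pow_le_pow_right hL (by omega)
    have hmark : L * (L * (L * 97 + 81) + 50) = 97 * L ^ 3 + 81 * L ^ 2 + 50 * L := by ring
    omega

open Classical in
theorem connectivityProgram_runs {n k : ℕ} (h : n ≤ 1 ∨ k = 0)
    (I : CognitiveRadioNetwork (Fin n) (Fin k)) :
    Runs connectivityProgram I.inputState (2 ^ 18)
      fun s => s.reg 0 = if I.Connectable then 1 else 0 := by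
  have h0 : I.inputState.reg 0 = n := by simp [inputState]
  have h1 : I.inputState.reg 1 = k := by simp [inputState]
  refine (Runs.ite (T := 8) (fun hn => ?_) fun hn => ?_).mono (by decide) fun _ h => h
  · simp only [Expr.value, h0] at hn
    obtain rfl : k = 0 := by omega
    refine (Runs.ite (T := 2) (fun hk => by exact (hk h1).elim) fun _ => .assign ?_).mono (by decide)
      fun _ h => h
    simp [State.setReg, Expr.value, not_connectable_of_isEmpty (by omega) I]
  · simp only [Expr.value, h0] at hn
    refine (Runs.skip ?_).mono (by omega) fun _ h => h
    -- Register 0 still holds `n`, which is already the answer: the empty graph is not connected, a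
    -- single vertex is.
    obtain rfl | rfl : n = 0 ∨ n = 1 := by omega
    · have : ¬ I.Connectable := fun ⟨_, _, hG⟩ => isEmptyElim hG.nonempty.some
      simp [h0, this]
    · simp [h0, connectable_of_unique I]

end CognitiveRadioNetwork

theorem add_le_min_add_one {n k : ℕ} (hn : 1 ≤ n) (hk : 1 ≤ k) :
    ((n + k : ℕ) : ℝ) ≤ min ((k : ℝ) * n) ((k : ℝ) + n * Real.logb 2 n) + 1 := by
  have hk' : (1 : ℝ) ≤ k := by exact_mod_cast hk
  have hn' : (1 : ℝ) ≤ n := by exact_mod_cast hn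
  rw [← min_add_add_right, le_min_iff]
  push_cast
  -- The first bound is `(k - 1) * (n - 1) ≥ 0`. In the second, the summand 1 pays for `n = 1`,
  -- where the logarithm vanishes.
  refine ⟨by nlinarith, ?_⟩
  rcases hn.eq_or_lt with rfl | hn
  · simp [add_comm]
  · have hn2 : (2 : ℝ) ≤ n := by exact_mod_cast hn
    have : 1 ≤ Real.logb 2 n := by
      rw [Real.le_logb_iff_rpow_le one_lt_two (by linarith)]
      simpa using hn2
    nlinarith

theorem decidesSpectrumConnectivity_connectivityProgram :
    DecidesSpectrumConnectivity CognitiveRadioNetwork.connectivityProgram fun n k =>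
      (2 : ℝ) ^ ((18 : ℝ) * (min ((k : ℝ) * n) ((k : ℝ) + n * Real.logb 2 n) + 1)) := by
  classical
  intro n k I
  have key : ∃ m : ℕ, (m : ℝ) ≤ min ((k : ℝ) * n) ((k : ℝ) + n * Real.logb 2 n) + 1 ∧
      RAM.Runs CognitiveRadioNetwork.connectivityProgram I.inputState (2 ^ (18 * m))
        fun s => s.reg 0 = if I.Connectable then 1 else 0 := by
    by_cases h : n ≤ 1 ∨ k = 0
    · refine ⟨1, ?_, CognitiveRadioNetwork.connectivityProgram_runs h I⟩
      have hlog : 0 ≤ Real.logb 2 n :=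
        div_nonneg (Real.log_natCast_nonneg n) (Real.log_nonneg one_le_two)
      have : 0 ≤ min ((k : ℝ) * n) ((k : ℝ) + n * Real.logb 2 n) :=
        le_min (by positivity) (by positivity)
      push_cast
      linarith
    · exact ⟨n + k, add_le_min_add_one (by omega) (by omega),
        CognitiveRadioNetwork.connectivityProgram_runs_of_two_le (by omega) (by omega) I⟩
  obtain ⟨m, hm, t, s, he, ht, hs⟩ := key
  refine ⟨t, s, he, ?_, fun h => by simp [hs, h], fun h => by simp [hs, h]⟩
  calc (t : ℝ) ≤ ((2 ^ (18 * m) : ℕ) : ℝ) := by exact_mod_cast ht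
    _ = (2 : ℝ) ^ ((18 : ℝ) * m) := by
      rw [Nat.cast_pow, Nat.cast_ofNat, ← Real.rpow_natCast, Nat.cast_mul, Nat.cast_ofNat]
    _ ≤ _ := Real.rpow_le_rpow_of_exponent_le one_le_two
      (mul_le_mul_of_nonneg_left hm (by norm_num))

theorem mainTheorem8 :
    SpectrumConnectivitySolvableInTwoPowO (fun n k => (k : ℝ) + n * Real.logb 2 n) ∧
    SpectrumConnectivitySolvableInTwoPowO
      (fun n k => min ((k : ℝ) * n) ((k : ℝ) + n * Real.logb 2 n)) := by
  refine ⟨⟨CognitiveRadioNetwork.connectivityProgram, 18, fun n k I => ?_⟩,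
    CognitiveRadioNetwork.connectivityProgram, 18,
    decidesSpectrumConnectivity_connectivityProgram⟩
  obtain ⟨t, s, he, ht, hs⟩ := decidesSpectrumConnectivity_connectivityProgram n k I
  refine ⟨t, s, he, ht.trans ?_, hs⟩
  refine Real.rpow_le_rpow_of_exponent_le one_le_two
    (mul_le_mul_of_nonneg_left ?_ (by norm_num))
  gcongr
  exact min_le_right _ _
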